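/- A $\Sigma_3$-circuit over Boolean variables $x_1,\dots,x_n$ is an OR of CNFs, $C=F_1\lor\dots\lor F_t$, in which the CNFs are allowed to share clauses: it has $t$ AND gates (one per CNF) and $r$ OR gates, each of which computes a clause (a disjunction of literals) and may feed several of the AND gates. A $\Sigma_3$-formula is a $\Sigma_3$-circuit in which no clause gate is shared by two CNFs. The size of $C$ is its number of gates excluding the output gate, i.e. $t+r$. Let $\mathrm{PAR}_n(x_1,\dots,x_n)=x_1\oplus\dots\oplus x_n$. (a) There is an absolute constant $c>0$ such that for every $n\ge 1$, every $\Sigma_3$-formula computing $\mathrm{PAR}_n$ has size at least $c\cdot 2^{\sqrt n}/n$; that is, its size is $\Omega\left(2^{\sqrt n}/n\right)$. (b) There is an absolute constant $c>0$ such that for every $n\ge 1$, every $\Sigma_3$-circuit computing $\mathrm{PAR}_n$ has size at least $c\cdot 2^{\sqrt{n/2}}/n$; that is, its size is $\Omega\bigl(2^{\sqrt{n/2}}/n\bigr)$. -/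

import Mathlib

/-- A literal over the variables `x_1, …, x_n`: the pair `(i, true)` is the variable `x_i` and
`(i, false)` is its negation. -/
abbrev Literal (n : ℕ) : Type := Fin n × Bool

/-- A clause: a disjunction of a finite set of literals. -/
abbrev Clause (n : ℕ) : Type := Finset (Literal n)

/-- The value of a clause at `x`: the OR of its literals. -/
def Clause.eval {n : ℕ} (K : Clause n) (x : Fin n → Bool) : Bool :=
  decide (∃ l ∈ K, x l.1 = l.2)

/-- A `Σ₃`-circuit (OR ∘ AND ∘ OR) over `x_1, …, x_n`, an OR of CNFs that may share clauses.
The output gate is the OR of all the AND gates. -/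
structure Sigma3Circuit (n : ℕ) where
  /-- The number of AND gates of the second layer. -/
  t : ℕ
  /-- The number of OR gates of the third layer. -/
  r : ℕ
  /-- The clause computed by an OR gate of the third layer. -/
  clause : Fin r → Clause n
  /-- The OR gates that feed a given AND gate, i.e. the clauses of the corresponding CNF. -/
  inputs : Fin t → Finset (Fin r)

namespace Sigma3Circuit

variable {n : ℕ}

/-- The value of the CNF with index `j` at `x`. -/
def evalCNF (C : Sigma3Circuit n) (j : Fin C.t) (x : Fin n → Bool) : Bool :=
  decide (∀ i ∈ C.inputs j, (C.clause i).eval x = true)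

/-- The value of the circuit at `x`: the OR of its CNFs. -/
def eval (C : Sigma3Circuit n) (x : Fin n → Bool) : Bool :=
  decide (∃ j, C.evalCNF j x = true)

/-- The circuit computes the Boolean function `f`. -/
def Computes (C : Sigma3Circuit n) (f : (Fin n → Bool) → Bool) : Prop :=
  ∀ x, C.eval x = f x

/-- The number of gates, excluding the output gate. -/
def size (C : Sigma3Circuit n) : ℕ := C.t + C.r

/-- The circuit is a `Σ₃`-formula: its CNFs do not share clauses (clause gates). Two distinct
gates may be labelled with the same clause. -/
def IsFormula (C : Sigma3Circuit n) : Prop :=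
  ∀ j k, j ≠ k → Disjoint (C.inputs j) (C.inputs k)

end Sigma3Circuit

instance parityXorCommutative : Std.Commutative Bool.xor := ⟨Bool.xor_comm⟩

instance parityXorAssociative : Std.Associative Bool.xor := ⟨Bool.xor_assoc⟩

/-- The parity function `x_1 ⊕ ⋯ ⊕ x_n`. -/
def parity (n : ℕ) (x : Fin n → Bool) : Bool :=
  Finset.univ.fold Bool.xor false x

/-!
A single bound is proved that covers both parts: every `Σ₃`-circuit for parity, with or without
shared clauses, has size at least `2 ^ √n / (2 n)`. The argument is the one of Paturi, Pudlák and
Zane.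

Every odd input `x` is accepted by some CNF of the circuit, and as this CNF rejects all neighbours
of `x`, it has for each variable `i` a clause that is *critical* at `x` for `i`: true at `x`, but
false once `x i` is flipped. Let the circuit have `r` clauses and `t` CNFs, and let `k` be the
integer part of `√n`. The odd inputs are counted in two classes.

* Inputs with a critical clause wider than `k`, hence of width at least `√n`: all literals of a
  clause are determined on the inputs at which it is critical for `i`, so a clause of width `w` is
  critical for `i` on at most `2 ^ (n - w)` inputs (`card_critical_mul_two_pow_le`). Hence there are
  at most `r n 2 ^ (n - √n)` inputs in this class. It does not matter here how many CNFs use a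
  clause.
* Inputs whose critical clauses all have width at most `k`: by the satisfiability coding lemma
  (`card_mul_two_rpow_le`), a CNF accepts at most `2 ^ (n - n / k)` of them, so there are at most
  `t 2 ^ (n - √n)` inputs in this class. The lemma is proved by revealing the bits of a solution `x`
  in the order of a permutation `σ` of the variables. A bit is redundant when its critical clause
  has all its other variables revealed earlier, which happens for a fraction of at least `1 / k` of
  all permutations. The subcubes obtained by freeing the redundant bits of the various solutions
  are pairwise disjoint, and the bound follows by averaging over `σ` and convexity.

The two classes together have `2 ^ (n - 1)` members, which gives `2 ^ √n ≤ 2 (r n + t)`.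
-/

/-! ### Flipping a bit -/

/-- The input `x` with its `i`-th bit flipped. -/
def flipBit {n : ℕ} (x : Fin n → Bool) (i : Fin n) : Fin n → Bool :=
  Function.update x i (!x i)

theorem flipBit_same {n : ℕ} (x : Fin n → Bool) (i : Fin n) : flipBit x i i = !x i := by
  simp [flipBit]

theorem flipBit_of_ne {n : ℕ} (x : Fin n → Bool) {i j : Fin n} (h : j ≠ i) :
    flipBit x i j = x j := by
  simp [flipBit, h]

theorem flipBit_flipBit {n : ℕ} (x : Fin n → Bool) (i : Fin n) :
    flipBit (flipBit x i) i = x := by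
  simp [flipBit]

theorem parity_flipBit {n : ℕ} (x : Fin n → Bool) (i : Fin n) :
    parity n (flipBit x i) = !parity n x := by
  unfold parity
  rw [← Finset.insert_erase (Finset.mem_univ i), Finset.fold_insert (Finset.notMem_erase _ _),
    Finset.fold_insert (Finset.notMem_erase _ _), flipBit_same,
    Finset.fold_congr (g := x) fun j hj => flipBit_of_ne x (Finset.ne_of_mem_erase hj)]
  simp

theorem two_mul_card_odd {n : ℕ} (hn : 1 ≤ n) :
    2 * (Finset.univ.filter fun x : Fin n → Bool => parity n x = true).card = 2 ^ n := by
  have h1 : (Finset.univ.filter fun x : Fin n → Bool => parity n x = true).card =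
      (Finset.univ.filter fun x : Fin n → Bool => ¬ parity n x = true).card := by
    refine Finset.card_bij' (fun x _ => flipBit x ⟨0, hn⟩) (fun x _ => flipBit x ⟨0, hn⟩) ?_ ?_
      (fun x _ => flipBit_flipBit x _) (fun x _ => flipBit_flipBit x _)
    · intro x hx
      simp_all [parity_flipBit]
    · intro x hx
      simp_all [parity_flipBit]
  have h2 := Finset.card_filter_add_card_filter_not
    (s := (Finset.univ : Finset (Fin n → Bool))) (fun x => parity n x = true)
  rw [← h1] at h2
  simp only [Finset.card_univ, Fintype.card_fun, Fintype.card_bool, Fintype.card_fin] at h2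
  omega

/-! ### Disjoint subcubes -/

/-- A Kraft inequality. The subcube of `x` with free coordinates `D x` has `2 ^ |D x|` points, and
the hypothesis says that the subcubes of distinct members of `G` are disjoint. -/
theorem sum_two_pow_card_le {n : ℕ} (G : Finset (Fin n → Bool))
    (D : (Fin n → Bool) → Finset (Fin n))
    (hD : ∀ x ∈ G, ∀ y ∈ G, (∀ i, i ∉ D x → i ∉ D y → x i = y i) → x = y) :
    ∑ x ∈ G, 2 ^ (D x).card ≤ 2 ^ n := by
  classical
  let Q : (Fin n → Bool) → Finset (Fin n → Bool) := fun x =>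
    Fintype.piFinset fun i => if i ∈ D x then Finset.univ else {x i}
  have hcard : ∀ x, (Q x).card = 2 ^ (D x).card := by
    intro x
    simp only [Q, Fintype.card_piFinset, apply_ite Finset.card, Finset.card_univ,
      Fintype.card_bool, Finset.card_singleton]
    rw [Finset.prod_ite]
    simp
  have hmem : ∀ x z, z ∈ Q x → ∀ i, i ∉ D x → z i = x i := by
    intro x z hz i hi
    have := Fintype.mem_piFinset.1 hz i
    simpa [hi] using this
  have hdisj : (G : Set (Fin n → Bool)).PairwiseDisjoint Q := by
    intro x hx y hy hxy
    refine Finset.disjoint_left.2 fun z hzx hzy => hxy (hD x hx y hy fun i hix hiy => ?_)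
    rw [← hmem x z hzx i hix, hmem y z hzy i hiy]
  calc ∑ x ∈ G, 2 ^ (D x).card = (G.biUnion Q).card := by
        rw [Finset.card_biUnion hdisj]
        exact Finset.sum_congr rfl fun x _ => (hcard x).symm
    _ ≤ (Finset.univ : Finset (Fin n → Bool)).card := Finset.card_le_univ _
    _ = 2 ^ n := by simp

/-! ### Critical clauses -/

/-- The clause `K` is critical at `x` for the variable `i`: it is true at `x`, and it becomes false
when the `i`-th bit of `x` is flipped. -/
def Clause.IsCritical {n : ℕ} (K : Clause n) (x : Fin n → Bool) (i : Fin n) : Prop :=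
  K.eval x = true ∧ K.eval (flipBit x i) = false

theorem Clause.IsCritical.eq_of_mem {n : ℕ} {K : Clause n} {x : Fin n → Bool} {i : Fin n}
    (h : K.IsCritical x i) {l : Literal n} (hl : l ∈ K) :
    l.2 = flipBit (fun j => !x j) i l.1 := by
  have : ¬ flipBit x i l.1 = l.2 := fun h' => of_decide_eq_false h.2 ⟨l, hl, h'⟩
  by_cases hi : l.1 = i
  · rw [hi, flipBit_same] at this ⊢
    revert this
    cases x i <;> cases l.2 <;> simp
  · rw [flipBit_of_ne _ hi] at this ⊢
    revert this
    cases x l.1 <;> cases l.2 <;> simp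

theorem Clause.IsCritical.mem {n : ℕ} {K : Clause n} {x : Fin n → Bool} {i : Fin n}
    (h : K.IsCritical x i) : (i, x i) ∈ K := by
  obtain ⟨l, hl, hx⟩ : ∃ l ∈ K, x l.1 = l.2 := by simpa [Clause.eval] using h.1
  have := h.eq_of_mem hl
  by_cases hi : l.1 = i
  · have hl' : l = (i, x i) := by rw [← hi, hx]
    rwa [← hl']
  · rw [flipBit_of_ne _ hi, ← hx] at this
    simp at this

/-- A clause that is critical somewhere contains no complementary literals, so its width is its
number of variables. -/
theorem Clause.IsCritical.card_image_fst {n : ℕ} {K : Clause n} {x : Fin n → Bool} {i : Fin n}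
    (h : K.IsCritical x i) : (K.image Prod.fst).card = K.card := by
  refine Finset.card_image_of_injOn fun l hl l' hl' hll => Prod.ext hll ?_
  rw [h.eq_of_mem hl, h.eq_of_mem hl', hll]

/-- The inputs at which `K` is critical for `i` agree on the variables of `K`, so that the subcubes
obtained from them by freeing these variables are disjoint. -/
theorem card_critical_mul_two_pow_le {n : ℕ} (K : Clause n) (i : Fin n)
    (G : Finset (Fin n → Bool)) (hG : ∀ x ∈ G, K.IsCritical x i) :
    G.card * 2 ^ K.card ≤ 2 ^ n := by
  rcases G.eq_empty_or_nonempty with rfl | ⟨x₀, hx₀⟩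
  · simp
  rw [← (hG x₀ hx₀).card_image_fst]
  have := sum_two_pow_card_le G (fun _ => K.image Prod.fst) ?_
  · simpa using this
  intro x hx y hy hxy
  funext j
  by_cases hj : j ∈ K.image Prod.fst
  · obtain ⟨l, hl, rfl⟩ := Finset.mem_image.1 hj
    have h1 := (hG x hx).eq_of_mem hl
    rw [(hG y hy).eq_of_mem hl] at h1
    by_cases hi : l.1 = i
    · rw [hi, flipBit_same, flipBit_same] at h1
      simpa [hi] using h1.symm
    · rw [flipBit_of_ne _ hi, flipBit_of_ne _ hi] at h1
      simpa using h1.symm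
  · exact hxy j hj hj

/-! ### The satisfiability coding lemma -/

open Classical in
/-- The variables whose value at a solution `x` of the CNF `F` is forced by the values of the
variables that precede them in the order `σ`: some clause of `F` consists of a literal of `i` and
of literals that are false at `x` and whose variables precede `i`. -/
def forcedVars {n : ℕ} (F : Finset (Clause n)) (σ : Equiv.Perm (Fin n)) (x : Fin n → Bool) :
    Finset (Fin n) :=
  Finset.univ.filter fun i => ∃ K ∈ F, ∃ b, (i, b) ∈ K ∧
    ∀ l ∈ K, l ≠ (i, b) → x l.1 ≠ l.2 ∧ σ l.1 < σ i

/-- If two solutions agree on the variables preceding `i`, and `i` is forced at one of them, then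
they agree on `i`. -/
theorem eq_of_mem_forcedVars {n : ℕ} {F : Finset (Clause n)} {σ : Equiv.Perm (Fin n)}
    {x y : Fin n → Bool} (hx : ∀ K ∈ F, K.eval x = true) (hy : ∀ K ∈ F, K.eval y = true)
    {i : Fin n} (hi : i ∈ forcedVars F σ x) (hxy : ∀ j, σ j < σ i → x j = y j) : x i = y i := by
  obtain ⟨K, hK, b, hb, hl⟩ := (Finset.mem_filter.1 hi).2
  have key : ∀ z : Fin n → Bool, K.eval z = true → (∀ j, σ j < σ i → x j = z j) → z i = b := by
    intro z hz hxz
    obtain ⟨l, hlK, hlz⟩ : ∃ l ∈ K, z l.1 = l.2 := by simpa [Clause.eval] using hz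
    by_cases hne : l = (i, b)
    · subst hne
      exact hlz
    · obtain ⟨h1, h2⟩ := hl l hlK hne
      exact absurd ((hxz _ h2).trans hlz) h1
  rw [key x (hx K hK) fun _ _ => rfl, key y (hy K hK) hxy]

theorem sum_two_pow_card_forcedVars_le {n : ℕ} (F : Finset (Clause n)) (σ : Equiv.Perm (Fin n))
    (G : Finset (Fin n → Bool)) (hG : ∀ x ∈ G, ∀ K ∈ F, K.eval x = true) :
    ∑ x ∈ G, 2 ^ (forcedVars F σ x).card ≤ 2 ^ n := by
  refine sum_two_pow_card_le G _ fun x hx y hy hxy => ?_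
  have main : ∀ m : Fin n, ∀ i, σ i = m → x i = y i := by
    intro m
    induction m using WellFoundedLT.induction with
    | ind m ih =>
      rintro i rfl
      have ih' : ∀ j, σ j < σ i → x j = y j := fun j hj => ih _ hj j rfl
      by_cases h1 : i ∈ forcedVars F σ x
      · exact eq_of_mem_forcedVars (hG x hx) (hG y hy) h1 ih'
      by_cases h2 : i ∈ forcedVars F σ y
      · exact (eq_of_mem_forcedVars (hG y hy) (hG x hx) h2 fun j hj => (ih' j hj).symm).symm
      exact hxy i h1 h2
  exact funext fun i => main _ i rfl

theorem Clause.IsCritical.mem_forcedVars {n : ℕ} {F : Finset (Clause n)} {K : Clause n}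
    (hK : K ∈ F) {x : Fin n → Bool} {i : Fin n} (h : K.IsCritical x i) {σ : Equiv.Perm (Fin n)}
    (hσ : ∀ j ∈ K.image Prod.fst, σ j ≤ σ i) : i ∈ forcedVars F σ x := by
  refine Finset.mem_filter.2 ⟨Finset.mem_univ _, K, hK, x i, h.mem, fun l hl hne => ?_⟩
  have hl2 := h.eq_of_mem hl
  have hi : l.1 ≠ i := by
    intro hi
    rw [hi, flipBit_same, Bool.not_not] at hl2
    exact hne (Prod.ext hi hl2)
  rw [flipBit_of_ne _ hi] at hl2
  refine ⟨by simp [hl2], lt_of_le_of_ne (hσ _ (Finset.mem_image_of_mem _ hl)) ?_⟩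
  exact fun h => hi (σ.injective h)

/-- A given element of `A` is the last one of `A` in a fraction of at least `1 / |A|` of all
permutations. -/
theorem factorial_le_card_mul_card_last {n : ℕ} (A : Finset (Fin n)) {i : Fin n} (hi : i ∈ A) :
    n.factorial ≤ A.card *
      (Finset.univ.filter fun σ : Equiv.Perm (Fin n) => ∀ j ∈ A, σ j ≤ σ i).card := by
  let S : Fin n → Finset (Equiv.Perm (Fin n)) := fun a =>
    Finset.univ.filter fun σ => ∀ j ∈ A, σ j ≤ σ a
  have hS : ∀ a ∈ A, (S a).card ≤ (S i).card := by
    intro a ha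
    refine Finset.card_le_card_of_injOn (fun σ => (Equiv.swap a i).trans σ) ?_ ?_
    · intro σ hσ
      have hσ' : ∀ j ∈ A, σ j ≤ σ a := by simpa [S] using hσ
      simp only [S, Finset.coe_filter, Finset.mem_univ, true_and, Set.mem_ofPred_eq,
        Equiv.trans_apply, Equiv.swap_apply_right]
      intro j hj
      refine hσ' _ ?_
      rw [Equiv.swap_apply_def]
      split_ifs <;> assumption
    · intro σ _ τ _ h
      ext j
      have := congrArg (fun e : Equiv.Perm (Fin n) => e (Equiv.swap a i j)) h
      simpa using congrArg Fin.val this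
  have hcover : (Finset.univ : Finset (Equiv.Perm (Fin n))) ⊆ A.biUnion S := by
    intro σ _
    obtain ⟨a, ha, hmax⟩ := A.exists_max_image σ ⟨i, hi⟩
    exact Finset.mem_biUnion.2 ⟨a, ha, by simpa [S] using hmax⟩
  calc n.factorial = (Finset.univ : Finset (Equiv.Perm (Fin n))).card := by
        rw [Finset.card_univ, Fintype.card_perm, Fintype.card_fin]
    _ ≤ (A.biUnion S).card := Finset.card_le_card hcover
    _ ≤ A.card * (S i).card := Finset.card_biUnion_le_card_mul _ _ _ hS

/-- On average over the permutations, a solution with a critical clause of width at most `k` for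
every variable has at least `n / k` forced variables. -/
theorem factorial_mul_le_sum_card_forcedVars {n k : ℕ} (F : Finset (Clause n))
    (x : Fin n → Bool) (hx : ∀ i, ∃ K ∈ F, K.IsCritical x i ∧ K.card ≤ k) :
    n.factorial * n ≤ k * ∑ σ : Equiv.Perm (Fin n), (forcedVars F σ x).card := by
  classical
  have hi : ∀ i : Fin n, n.factorial ≤
      k * (Finset.univ.filter fun σ : Equiv.Perm (Fin n) => i ∈ forcedVars F σ x).card := by
    intro i
    obtain ⟨K, hK, hcrit, hk⟩ := hx i
    refine (factorial_le_card_mul_card_last (K.image Prod.fst)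
      (Finset.mem_image_of_mem Prod.fst hcrit.mem)).trans (Nat.mul_le_mul ?_ ?_)
    · rwa [hcrit.card_image_fst]
    · exact Finset.card_le_card fun σ hσ =>
        Finset.mem_filter.2 ⟨Finset.mem_univ _, hcrit.mem_forcedVars hK (Finset.mem_filter.1 hσ).2⟩
  have hswap : ∑ σ : Equiv.Perm (Fin n), (forcedVars F σ x).card =
      ∑ i : Fin n,
        (Finset.univ.filter fun σ : Equiv.Perm (Fin n) => i ∈ forcedVars F σ x).card := by
    simp only [Finset.card_filter]
    rw [Finset.sum_comm]
    refine Finset.sum_congr rfl fun σ _ => ?_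
    simp
  rw [hswap, Finset.mul_sum]
  calc n.factorial * n = ∑ _i : Fin n, n.factorial := by simp [mul_comm]
    _ ≤ _ := Finset.sum_le_sum fun i _ => hi i

/-- The satisfiability coding lemma: a CNF has at most `2 ^ (n - n / k)` solutions at which it has
a critical clause of width at most `k` for every variable. -/
theorem card_mul_two_rpow_le {n k : ℕ} (hk : 0 < k) (F : Finset (Clause n))
    (G : Finset (Fin n → Bool)) (hG : ∀ x ∈ G, ∀ K ∈ F, K.eval x = true)
    (hcrit : ∀ x ∈ G, ∀ i, ∃ K ∈ F, K.IsCritical x i ∧ K.card ≤ k) :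
    (G.card : ℝ) * (2 : ℝ) ^ ((n : ℝ) / k) ≤ 2 ^ n := by
  have hN : (0 : ℝ) < n.factorial := by exact_mod_cast n.factorial_pos
  have hperm : ((Finset.univ : Finset (Equiv.Perm (Fin n))).card : ℝ) = n.factorial := by
    rw [Finset.card_univ, Fintype.card_perm, Fintype.card_fin]
  have hconv : ConvexOn ℝ Set.univ fun t : ℝ => (2 : ℝ) ^ t :=
    convexOn_rpow_left (by norm_num)
  have hjensen : ∀ x ∈ G, (n.factorial : ℝ) * (2 : ℝ) ^ ((n : ℝ) / k) ≤
      ∑ σ : Equiv.Perm (Fin n), (2 : ℝ) ^ (forcedVars F σ x).card := by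
    intro x hx
    have havg : (n : ℝ) / k ≤ ∑ σ : Equiv.Perm (Fin n),
        (n.factorial : ℝ)⁻¹ • ((forcedVars F σ x).card : ℝ) := by
      have h : (n.factorial : ℝ) * n ≤
          k * ∑ σ : Equiv.Perm (Fin n), ((forcedVars F σ x).card : ℝ) := by
        exact_mod_cast factorial_mul_le_sum_card_forcedVars F x (hcrit x hx)
      rw [← Finset.smul_sum, smul_eq_mul, inv_mul_eq_div,
        div_le_div_iff₀ (by exact_mod_cast hk) hN]
      linarith
    have h := hconv.map_sum_le (t := (Finset.univ : Finset (Equiv.Perm (Fin n))))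
      (w := fun _ => (n.factorial : ℝ)⁻¹) (p := fun σ => ((forcedVars F σ x).card : ℝ))
      (fun _ _ => by positivity)
      (by rw [Finset.sum_const, nsmul_eq_mul, hperm, mul_inv_cancel₀ hN.ne'])
      (fun _ _ => Set.mem_univ _)
    rw [← Finset.smul_sum (s := Finset.univ)
      (f := fun σ => (2 : ℝ) ^ ((forcedVars F σ x).card : ℝ)), smul_eq_mul] at h
    have h2 := (Real.rpow_le_rpow_of_exponent_le one_le_two havg).trans h
    rw [inv_mul_eq_div, le_div_iff₀ hN, mul_comm] at h2
    simpa only [Real.rpow_natCast] using h2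
  have hsum : (G.card : ℝ) * (n.factorial * (2 : ℝ) ^ ((n : ℝ) / k)) ≤
      n.factorial * 2 ^ n := by
    calc (G.card : ℝ) * (n.factorial * (2 : ℝ) ^ ((n : ℝ) / k))
        = ∑ _x ∈ G, (n.factorial : ℝ) * (2 : ℝ) ^ ((n : ℝ) / k) := by simp
      _ ≤ ∑ x ∈ G, ∑ σ : Equiv.Perm (Fin n), (2 : ℝ) ^ (forcedVars F σ x).card :=
          Finset.sum_le_sum hjensen
      _ = ∑ σ : Equiv.Perm (Fin n), ∑ x ∈ G, (2 : ℝ) ^ (forcedVars F σ x).card :=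
          Finset.sum_comm
      _ ≤ ∑ _σ : Equiv.Perm (Fin n), (2 : ℝ) ^ n :=
          Finset.sum_le_sum fun σ _ => by
            exact_mod_cast sum_two_pow_card_forcedVars_le F σ G hG
      _ = n.factorial * 2 ^ n := by rw [Finset.sum_const, nsmul_eq_mul, hperm]
  refine le_of_mul_le_mul_left ?_ hN
  linarith

/-! ### Circuits for parity -/

/-- A CNF of a circuit for parity has a critical clause for every variable at each of its
solutions. -/
theorem Sigma3Circuit.Computes.exists_isCritical {n : ℕ} {C : Sigma3Circuit n}
    (hC : C.Computes (parity n)) {j : Fin C.t} {x : Fin n → Bool} (hx : C.evalCNF j x = true)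
    (i : Fin n) : ∃ a ∈ C.inputs j, (C.clause a).IsCritical x i := by
  have hodd : ∀ y, C.evalCNF j y = true → parity n y = true := by
    intro y hy
    rw [← hC y]
    simpa [Sigma3Circuit.eval] using ⟨j, hy⟩
  have hflip : ¬ C.evalCNF j (flipBit x i) = true := by
    intro h
    have := hodd _ h
    rw [parity_flipBit, hodd x hx] at this
    simp at this
  have hall : ∀ a ∈ C.inputs j, (C.clause a).eval x = true := by
    simpa [Sigma3Circuit.evalCNF] using hx
  obtain ⟨a, ha, hfalse⟩ : ∃ a ∈ C.inputs j, (C.clause a).eval (flipBit x i) = false := by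
    simpa [Sigma3Circuit.evalCNF] using hflip
  exact ⟨a, ha, hall a ha, hfalse⟩

/-- The number of inputs at which some clause wider than `k` is critical. -/
theorem Sigma3Circuit.card_wide_critical_mul_le {n : ℕ} (C : Sigma3Circuit n) (k : ℕ)
    (W : Finset (Fin n → Bool))
    (hW : ∀ x ∈ W, ∃ a i, (C.clause a).IsCritical x i ∧ k < (C.clause a).card) :
    W.card * 2 ^ (k + 1) ≤ C.r * n * 2 ^ n := by
  classical
  let B : Fin C.r × Fin n → Finset (Fin n → Bool) := fun p =>
    W.filter fun x => (C.clause p.1).IsCritical x p.2 ∧ k < (C.clause p.1).card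
  have hsub : W ⊆ Finset.univ.biUnion B := by
    intro x hx
    obtain ⟨a, i, h⟩ := hW x hx
    exact Finset.mem_biUnion.2 ⟨(a, i), Finset.mem_univ _, Finset.mem_filter.2 ⟨hx, h⟩⟩
  have hB : ∀ p, (B p).card * 2 ^ (k + 1) ≤ 2 ^ n := by
    intro p
    by_cases hp : k < (C.clause p.1).card
    · exact (Nat.mul_le_mul_left _ (Nat.pow_le_pow_right (by norm_num) hp)).trans
        (card_critical_mul_two_pow_le _ p.2 _ fun x hx => (Finset.mem_filter.1 hx).2.1)
    · simp [B, hp]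
  calc W.card * 2 ^ (k + 1) ≤ (∑ p, (B p).card) * 2 ^ (k + 1) :=
        Nat.mul_le_mul_right _ ((Finset.card_le_card hsub).trans Finset.card_biUnion_le)
    _ = ∑ p, (B p).card * 2 ^ (k + 1) := Finset.sum_mul _ _ _
    _ ≤ ∑ _p : Fin C.r × Fin n, 2 ^ n := Finset.sum_le_sum fun p _ => hB p
    _ = C.r * n * 2 ^ n := by simp

/-- The number of inputs that are accepted by a circuit for parity and at which no clause wider than
`k` is critical. -/
theorem Sigma3Circuit.Computes.card_narrow_mul_le {n k : ℕ} {C : Sigma3Circuit n}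
    (hC : C.Computes (parity n)) (hk : 0 < k) (N : Finset (Fin n → Bool))
    (hodd : ∀ x ∈ N, parity n x = true)
    (hN : ∀ x ∈ N, ∀ a i, (C.clause a).IsCritical x i → (C.clause a).card ≤ k) :
    (N.card : ℝ) * (2 : ℝ) ^ ((n : ℝ) / k) ≤ C.t * 2 ^ n := by
  classical
  let B : Fin C.t → Finset (Fin n → Bool) := fun j => N.filter fun x => C.evalCNF j x = true
  have hsub : N ⊆ Finset.univ.biUnion B := by
    intro x hx
    obtain ⟨j, hj⟩ : ∃ j, C.evalCNF j x = true := by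
      have := (hC x).trans (hodd x hx)
      simpa [Sigma3Circuit.eval] using this
    exact Finset.mem_biUnion.2 ⟨j, Finset.mem_univ _, Finset.mem_filter.2 ⟨hx, hj⟩⟩
  have hB : ∀ j, ((B j).card : ℝ) * (2 : ℝ) ^ ((n : ℝ) / k) ≤ 2 ^ n := by
    intro j
    refine card_mul_two_rpow_le hk ((C.inputs j).image C.clause) (B j) ?_ ?_
    · intro x hx K hK
      obtain ⟨a, ha, rfl⟩ := Finset.mem_image.1 hK
      have hall : ∀ a ∈ C.inputs j, (C.clause a).eval x = true := by
        simpa [Sigma3Circuit.evalCNF] using (Finset.mem_filter.1 hx).2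
      exact hall a ha
    · intro x hx i
      obtain ⟨hxN, hxj⟩ := Finset.mem_filter.1 hx
      obtain ⟨a, ha, hcrit⟩ := hC.exists_isCritical hxj i
      exact ⟨C.clause a, Finset.mem_image_of_mem _ ha, hcrit, hN x hxN a i hcrit⟩
  have hcard : (N.card : ℝ) ≤ ∑ j, ((B j).card : ℝ) := by
    exact_mod_cast (Finset.card_le_card hsub).trans Finset.card_biUnion_le
  calc (N.card : ℝ) * (2 : ℝ) ^ ((n : ℝ) / k)
      ≤ (∑ j, ((B j).card : ℝ)) * (2 : ℝ) ^ ((n : ℝ) / k) := by gcongr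
    _ = ∑ j, ((B j).card : ℝ) * (2 : ℝ) ^ ((n : ℝ) / k) := Finset.sum_mul _ _ _
    _ ≤ ∑ _j : Fin C.t, (2 : ℝ) ^ n := Finset.sum_le_sum fun j _ => hB j
    _ = C.t * 2 ^ n := by simp

theorem Sigma3Circuit.Computes.two_rpow_sqrt_le_size {n : ℕ} (hn : 1 ≤ n) {C : Sigma3Circuit n}
    (hC : C.Computes (parity n)) :
    1 / 2 * ((2 : ℝ) ^ Real.sqrt n / n) ≤ C.size := by
  classical
  let odd : Finset (Fin n → Bool) := Finset.univ.filter fun x => parity n x = true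
  let wide : (Fin n → Bool) → Prop := fun x =>
    ∃ a i, (C.clause a).IsCritical x i ∧ n.sqrt < (C.clause a).card
  have hk : 0 < n.sqrt := Nat.sqrt_pos.2 hn
  have hn1 : (1 : ℝ) ≤ n := by exact_mod_cast hn
  have hsplit : 2 * ((odd.filter wide).card + (odd.filter fun x => ¬ wide x).card) = 2 ^ n := by
    rw [Finset.card_filter_add_card_filter_not, two_mul_card_odd hn]
  have hsplit' : 2 * (((odd.filter wide).card : ℝ) + (odd.filter fun x => ¬ wide x).card) =
      2 ^ n := by exact_mod_cast hsplit
  have hwide : ((odd.filter wide).card : ℝ) * (2 : ℝ) ^ Real.sqrt n ≤ C.r * n * 2 ^ n := by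
    have h : ((odd.filter wide).card : ℝ) * 2 ^ (n.sqrt + 1) ≤ C.r * n * 2 ^ n := by
      exact_mod_cast C.card_wide_critical_mul_le n.sqrt (odd.filter wide)
        fun x hx => (Finset.mem_filter.1 hx).2
    refine le_trans ?_ h
    gcongr
    rw [← Real.rpow_natCast]
    refine Real.rpow_le_rpow_of_exponent_le one_le_two ?_
    push_cast
    exact Real.real_sqrt_le_nat_sqrt_succ
  have hnarrow : ((odd.filter fun x => ¬ wide x).card : ℝ) * (2 : ℝ) ^ Real.sqrt n ≤
      C.t * 2 ^ n := by
    refine le_trans ?_ (hC.card_narrow_mul_le hk (odd.filter fun x => ¬ wide x) ?_ ?_)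
    · gcongr
      · exact one_le_two
      · rw [le_div_iff₀ (by exact_mod_cast hk)]
        calc Real.sqrt n * (n.sqrt : ℝ) ≤ Real.sqrt n * Real.sqrt n := by
              gcongr
              exact Real.nat_sqrt_le_real_sqrt
          _ = n := Real.mul_self_sqrt (Nat.cast_nonneg n)
    · exact fun x hx => (Finset.mem_filter.1 (Finset.mem_filter.1 hx).1).2
    · intro x hx a i h
      by_contra hlt
      exact (Finset.mem_filter.1 hx).2 ⟨a, i, h, not_le.1 hlt⟩
  have hsum : 2 ^ n * (2 : ℝ) ^ Real.sqrt n ≤ 2 ^ n * (2 * (C.r * n + C.t)) := by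
    linear_combination 2 * hwide + 2 * hnarrow - (2 : ℝ) ^ Real.sqrt n * hsplit'
  have hpow := le_of_mul_le_mul_left hsum (by positivity)
  have ht : (C.t : ℝ) ≤ C.t * n := le_mul_of_one_le_right (Nat.cast_nonneg _) hn1
  have hsize : (C.size : ℝ) = C.t + C.r := by simp [Sigma3Circuit.size]
  rw [hsize, ← mul_div_assoc, div_le_iff₀ (by linarith)]
  linarith

theorem mainTheorem3 :
    (∃ c : ℝ, 0 < c ∧ ∀ n : ℕ, 1 ≤ n → ∀ C : Sigma3Circuit n, C.IsFormula →
      C.Computes (parity n) →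
        c * ((2 : ℝ) ^ Real.sqrt (n : ℝ) / (n : ℝ)) ≤ (C.size : ℝ)) ∧
    (∃ c : ℝ, 0 < c ∧ ∀ n : ℕ, 1 ≤ n → ∀ C : Sigma3Circuit n,
      C.Computes (parity n) →
        c * ((2 : ℝ) ^ Real.sqrt ((n : ℝ) / 2) / (n : ℝ)) ≤ (C.size : ℝ)) := by
  refine ⟨⟨1 / 2, by norm_num, fun n hn C _ hC => hC.two_rpow_sqrt_le_size hn⟩,
    ⟨1 / 2, by norm_num, fun n hn C hC => le_trans ?_ (hC.two_rpow_sqrt_le_size hn)⟩⟩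
  gcongr
  · exact one_le_two
  · exact half_le_self (Nat.cast_nonneg n)
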